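/- Fix a first-order language $L$ with at least one constant and infinitely many variables. A (general) clause is $H\leftarrow L_1,\dots,L_n$ with $H$ an atom and $L_1,\dots,L_n$ ($n\ge 0$) literals; a (general) program is a finite set of clauses; a query is a finite, possibly empty, sequence of literals. **LDNF-resolution.** Given a program $P$ and a query $Q$, the interpreter builds the LDNF-tree of $P\cup\{Q\}$, whose branches are the LDNF-derivations, always selecting the leftmost literal. If it is an atom, it is resolved (by a most general unifier) with variants of the clauses of $P$ that are standardized apart from everything used before on the branch. If it is $\neg A$ with $A$ ground, the subsidiary LDNF-tree of $P\cup\{A\}$ is built: if that tree is finitely failed (finite, all leaves failed), $\neg A$ is deleted and the derivation goes on; if it is finite and contains the empty query, the derivation fails; if it is finite, does not contain the empty query, but has a floundered leaf, the derivation flounders; if its construction diverges, the derivation counts as infinite. If it is $\neg A$ with $A$ not ground, the derivation is finite (it flounders). An LDNF-descendant of $P\cup\{Q\}$ is any query that occurs in this process, including $Q$ and all queries in the (nested) subsidiary trees. **Notions.** A relation is *defined in* $P$ if it occurs in the head of a clause of $P$, and an atom is defined in $P$ if its relation is; $P$ *extends* $R$ if no relation defined in $P$ occurs in $R$. Let $\mathrm{Neg}_P$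 be the set of relations that occur in a negative literal in a clause of $P$, $\mathrm{Neg}^*_P$ the set of relations on which those of $\mathrm{Neg}_P$ depend (reflexive-transitive closure of "occurs in the body of a clause of $P$ defining"), and $P^-$ the set of clauses of $P$ that define relations in $\mathrm{Neg}^*_P$. A model $M$ of $P$ is *complete* if its restriction to the relations in $\mathrm{Neg}^*_P$ is a model of Clark's completion $\mathrm{comp}(P^-)$ (a condition that is void if $\mathrm{Neg}^*_P=\emptyset$; in the completion, relations in $\mathrm{Neg}^*_P$ without clauses are false). A *level mapping* is a function $|\cdot|$ from ground atoms to $\mathbb N$, extended by $|\neg A|=|A|$. $P$ is *acceptable* with respect to $|\cdot|$ and $M$ if for every ground instance $A\leftarrow\mathbf A,B,\mathbf B$ of a clause of $P$, $M\models\mathbf A$ implies $|A|>|B|$. An atom $A$ is *bounded* with respect to $|\cdot|$ if the set of all $|A'|$, $A'$ a ground instance of $A$, is finite. A class $\mathcal C$ of queries is *$P$-closed* if it contains all non-empty prefixes of its elements and, for each $Q\in\mathcal C$, all LDNF-descendants of $P\cup\{Q\}$. **Theorem.** Let $P$ and $R$ be programs such that $P$ extends $R$, let $M$ be a complete model of $P\cup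 R$, and let $\mathcal C$ be a $(P\cup R)$-closed class of queries. Suppose that * $P$ is acceptable with respect to a level mapping $|\cdot|$ and $M$; * for all queries $Q\in\mathcal C$, all LDNF-derivations of $R\cup\{Q\}$ are finite; * for all atoms $A\in\mathcal C$, if $A$ is defined in $P$ then $A$ is bounded with respect to $|\cdot|$. Then for all queries $Q\in\mathcal C$, all LDNF-derivations of $(P\cup R)\cup\{Q\}$ are finite. -/

import Mathlib

/-!
General logic programs over a fixed first-order language `L` (function symbols `L.Functions`,
relation symbols `L.Relations`, variables `ℕ`), LDNF-resolution, level mappings, acceptability.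
-/

namespace LP

universe u v w

/-! ### Syntax -/

/-- A relation symbol together with its arity. -/
abbrev RelSym (L : FirstOrder.Language.{u, v}) : Type v := Σ n : ℕ, L.Relations n

/-- Atoms whose terms have variables in `α`; `Atom L Empty` is the Herbrand base. -/
structure Atom (L : FirstOrder.Language.{u, v}) (α : Type) where
  rel : RelSym L
  args : Fin rel.1 → L.Term α

inductive Literal (L : FirstOrder.Language.{u, v}) (α : Type) where
  | pos (A : Atom L α) : Literal L α
  | neg (A : Atom L α) : Literal L α

/-- A general clause `head ← body`. -/
structure Clause (L : FirstOrder.Language.{u, v}) where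
  head : Atom L ℕ
  body : List (Literal L ℕ)

/-- A general query. -/
abbrev Query (L : FirstOrder.Language.{u, v}) := List (Literal L ℕ)

/-- A set of general clauses (finiteness is stated where programs are introduced). -/
abbrev Program (L : FirstOrder.Language.{u, v}) := Set (Clause L)

section Terms

variable {L : FirstOrder.Language.{u, v}} {α β : Type}

def Atom.subst (A : Atom L α) (σ : α → L.Term β) : Atom L β :=
  ⟨A.rel, fun i => (A.args i).subst σ⟩

def Literal.atom : Literal L α → Atom L α
  | .pos A => A
  | .neg A => A

def Literal.rel (l : Literal L α) : RelSym L := l.atom.rel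

def Literal.subst : Literal L α → (α → L.Term β) → Literal L β
  | .pos A, σ => .pos (A.subst σ)
  | .neg A, σ => .neg (A.subst σ)

def Query.subst (Q : Query L) (σ : ℕ → L.Term ℕ) : Query L := Q.map fun l => l.subst σ

def Clause.subst (c : Clause L) (σ : ℕ → L.Term ℕ) : Clause L :=
  ⟨c.head.subst σ, Query.subst c.body σ⟩

def Atom.vars (A : Atom L ℕ) : Set ℕ := {x | ∃ i, x ∈ (A.args i).varFinset}

def Query.vars (Q : Query L) : Set ℕ := {x | ∃ l ∈ Q, x ∈ l.atom.vars}

def Clause.vars (c : Clause L) : Set ℕ := c.head.vars ∪ Query.vars c.body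

def Atom.IsGround (A : Atom L ℕ) : Prop := A.vars = ∅

/-- The variant of a clause obtained by a renaming of the variables. -/
def Clause.rename (c : Clause L) (ρ : Equiv.Perm ℕ) : Clause L :=
  c.subst fun x => FirstOrder.Language.Term.var (ρ x)

/-- The domain of a substitution. -/
def substDom (θ : ℕ → L.Term ℕ) : Set ℕ := {x | θ x ≠ FirstOrder.Language.Term.var x}

/-- The variables that occur in a substitution, in its domain or in its range. -/
def substVars (θ : ℕ → L.Term ℕ) : Set ℕ :=
  substDom θ ∪ {y | ∃ x ∈ substDom θ, y ∈ (θ x).varFinset}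

/-- `θ` is a most general unifier of `A` and `B` (a substitution with finite domain). -/
def IsMGU (θ : ℕ → L.Term ℕ) (A B : Atom L ℕ) : Prop :=
  (substDom θ).Finite ∧ A.subst θ = B.subst θ ∧
    ∀ σ : ℕ → L.Term ℕ, A.subst σ = B.subst σ →
      ∃ δ : ℕ → L.Term ℕ, ∀ x, σ x = (θ x).subst δ

end Terms

/-! ### LDNF-resolution -/

section Resolution

variable {L : FirstOrder.Language.{u, v}}

/-- A node of an LDNF-tree: the current query, and the set of the variables that have been used on
the branch up to it (in queries, input clauses and mgus). -/
structure Node (L : FirstOrder.Language.{u, v}) where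
  used : Set ℕ
  query : Query L

/-- The root of the LDNF-tree of a query. -/
def Node.root (Q : Query L) : Node L := ⟨Query.vars Q, Q⟩

/-- A resolution step on a query whose first literal is the atom `A`: the input clause is a variant
of a program clause, standardized apart from everything used so far on the branch. -/
inductive Resolves (P : Program L) : Node L → Node L → Prop
  | intro (V : Set ℕ) (A : Atom L ℕ) (T : Query L) (c : Clause L) (hc : c ∈ P)
      (ρ : Equiv.Perm ℕ) (hρ : Disjoint (c.rename ρ).vars V)
      (θ : ℕ → L.Term ℕ) (hθ : IsMGU θ A (c.rename ρ).head) :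
      Resolves P ⟨V, .pos A :: T⟩
        ⟨V ∪ (c.rename ρ).vars ∪ substVars θ, Query.subst ((c.rename ρ).body ++ T) θ⟩

/-- The outcome of a finite LDNF-tree: it is successful if some leaf is the empty query, it is
finitely failed if every leaf is failed, otherwise it is floundered. -/
inductive Outcome where
  | failed
  | floundered
  | succeeded

open Classical in
/-- The outcome of a tree, given the set of the outcomes of the immediate subtrees. -/
noncomputable def Outcome.combine (S : Set Outcome) : Outcome :=
  if Outcome.succeeded ∈ S then .succeeded
  else if Outcome.floundered ∈ S then .floundered
  else .failed

/-- `FinTree P s o`: the LDNF-tree below the node `s`, including all the subsidiary trees that it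
calls for, is finite (has no infinite branch), and its outcome is `o`. -/
inductive FinTree (P : Program L) : Node L → Outcome → Prop
  | empty (V : Set ℕ) : FinTree P ⟨V, []⟩ .succeeded
  | pos (V : Set ℕ) (A : Atom L ℕ) (T : Query L) (f : Node L → Outcome)
      (h : ∀ s, Resolves P ⟨V, .pos A :: T⟩ s → FinTree P s (f s)) :
      FinTree P ⟨V, .pos A :: T⟩
        (Outcome.combine {o | ∃ s, Resolves P ⟨V, .pos A :: T⟩ s ∧ o = f s})
  | negNonground (V : Set ℕ) (A : Atom L ℕ) (T : Query L) (hA : ¬ A.IsGround) :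
      FinTree P ⟨V, .neg A :: T⟩ .floundered
  | negSucceeded (V : Set ℕ) (A : Atom L ℕ) (T : Query L) (hA : A.IsGround)
      (h : FinTree P (Node.root [.pos A]) .succeeded) :
      FinTree P ⟨V, .neg A :: T⟩ .failed
  | negFloundered (V : Set ℕ) (A : Atom L ℕ) (T : Query L) (hA : A.IsGround)
      (h : FinTree P (Node.root [.pos A]) .floundered) :
      FinTree P ⟨V, .neg A :: T⟩ .floundered
  | negFailed (V : Set ℕ) (A : Atom L ℕ) (T : Query L) (o : Outcome) (hA : A.IsGround)
      (h : FinTree P (Node.root [.pos A]) .failed) (hT : FinTree P ⟨V, T⟩ o) :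
      FinTree P ⟨V, .neg A :: T⟩ o

/-- The LDNF-tree of `P ∪ {Q}` is finitely failed. -/
def FinitelyFailed (P : Program L) (Q : Query L) : Prop := FinTree P (Node.root Q) .failed

/-- The moves of the LDNF-interpreter: a resolution step; the call of the subsidiary tree of `A` by
a query with first literal `¬A`, `A` ground; the deletion of such a literal `¬A` once the subsidiary
tree is finitely failed. A query whose first literal is negative and not ground (floundering) and
the empty query admit no move. -/
inductive Move (P : Program L) : Node L → Node L → Prop
  | resolve (s t : Node L) (h : Resolves P s t) : Move P s t
  | call (V : Set ℕ) (A : Atom L ℕ) (T : Query L) (hA : A.IsGround) :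
      Move P ⟨V, .neg A :: T⟩ (Node.root [.pos A])
  | naf (V : Set ℕ) (A : Atom L ℕ) (T : Query L) (hA : A.IsGround)
      (h : FinitelyFailed P [.pos A]) :
      Move P ⟨V, .neg A :: T⟩ ⟨V, T⟩

/-- `Q'` is an LDNF-descendant of `P ∪ {Q}`. -/
def IsDescendant (P : Program L) (Q Q' : Query L) : Prop :=
  ∃ V : Set ℕ, Relation.ReflTransGen (Move P) (Node.root Q) ⟨V, Q'⟩

/-- All LDNF-derivations of `P ∪ {Q}` are finite, that is, the interpreter cannot run forever on
`Q`. An infinite sequence of moves is an infinite branch of the tree of `Q`, or follows a branch up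
to a query whose subsidiary tree the interpreter diverges on (by an infinite branch or by an
infinite nesting of subsidiary trees), in which case the main derivation counts as infinite. -/
def AllDerivationsFinite (P : Program L) (Q : Query L) : Prop :=
  ¬ ∃ s : ℕ → Node L, s 0 = Node.root Q ∧ ∀ n, Move P (s n) (s (n + 1))

/-- `P`-closed classes of queries. -/
def IsClosedClass (P : Program L) (C : Set (Query L)) : Prop :=
  (∀ Q ∈ C, ∀ Q' : Query L, Q' ≠ [] → Q' <+: Q → Q' ∈ C) ∧
    ∀ Q ∈ C, ∀ Q' : Query L, IsDescendant P Q Q' → Q' ∈ C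

end Resolution

/-! ### Relations of a program -/

section Relations

variable {L : FirstOrder.Language.{u, v}}

def DefinedIn (P : Program L) (p : RelSym L) : Prop := ∃ c ∈ P, c.head.rel = p

def OccursIn (P : Program L) (p : RelSym L) : Prop :=
  ∃ c ∈ P, c.head.rel = p ∨ ∃ l ∈ c.body, l.rel = p

/-- `P` extends `R`: no relation defined in `P` occurs in `R`. -/
def Extends (P R : Program L) : Prop := ∀ p, DefinedIn P p → ¬ OccursIn R p

def RefersTo (P : Program L) (p q : RelSym L) : Prop :=
  ∃ c ∈ P, c.head.rel = p ∧ ∃ l ∈ c.body, l.rel = q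

def DependsOn (P : Program L) : RelSym L → RelSym L → Prop := Relation.ReflTransGen (RefersTo P)

/-- The relations that occur in a negative literal of a clause of `P`. -/
def Neg (P : Program L) : Set (RelSym L) := {p | ∃ c ∈ P, ∃ A, .neg A ∈ c.body ∧ A.rel = p}

def NegStar (P : Program L) : Set (RelSym L) := {q | ∃ p ∈ Neg P, DependsOn P p q}

/-- `P⁻`, the clauses of `P` that define a relation of `NegStar P`. -/
def negPart (P : Program L) : Program L := {c ∈ P | c.head.rel ∈ NegStar P}

end Relations

/-! ### Models (arbitrary first-order structures; `=` is identity) -/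

section Models

variable {L : FirstOrder.Language.{u, v}} {α : Type}

def Atom.Realize {D : Type w} [L.Structure D] (A : Atom L α) (x : α → D) : Prop :=
  FirstOrder.Language.Structure.RelMap A.rel.2 fun i => (A.args i).realize x

def Literal.Realize {D : Type w} [L.Structure D] : Literal L α → (α → D) → Prop
  | .pos A, x => A.Realize x
  | .neg A, x => ¬ A.Realize x

variable (D : Type w)

/-- The structure is a model of the program `P`. -/
def IsModel [L.Structure D] (P : Program L) : Prop :=
  ∀ c ∈ P, ∀ x : ℕ → D, (∀ l ∈ c.body, l.Realize x) → c.head.Realize x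

/-- Clark's free equality axioms. -/
structure FreeEquality (L : FirstOrder.Language.{u, v}) (D : Type w) [L.Structure D] : Prop where
  inj : ∀ (n : ℕ) (f : L.Functions n) (a b : Fin n → D),
    FirstOrder.Language.Structure.funMap f a = FirstOrder.Language.Structure.funMap f b → a = b
  ne : ∀ (m n : ℕ) (f : L.Functions m) (g : L.Functions n) (a : Fin m → D) (b : Fin n → D),
    (⟨m, f⟩ : Σ k, L.Functions k) ≠ ⟨n, g⟩ →
      FirstOrder.Language.Structure.funMap f a ≠ FirstOrder.Language.Structure.funMap g b
  acyclic : ∀ (t : L.Term ℕ) (y : ℕ), y ∈ t.varFinset → t ≠ FirstOrder.Language.Term.var y →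
    ∀ x : ℕ → D, t.realize x ≠ x y

/-- The structure is a model of Clark's completion `comp(P)`: the free equality axioms, and for every
relation symbol `p` its completed definition (so `p` is false everywhere if it has no clause). -/
def IsModelComp [L.Structure D] (P : Program L) : Prop :=
  FreeEquality L D ∧
    ∀ (p : RelSym L) (d : Fin p.1 → D),
      FirstOrder.Language.Structure.RelMap p.2 d ↔
        ∃ c ∈ P, ∃ ts : Fin p.1 → L.Term ℕ, c.head = ⟨p, ts⟩ ∧
          ∃ x : ℕ → D, (∀ i, d i = (ts i).realize x) ∧ ∀ l ∈ c.body, l.Realize x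

/-- The restriction of a structure to the relations in `S`: the other relations become empty. -/
@[reducible]
def restrict [L.Structure D] (S : Set (RelSym L)) : L.Structure D where
  funMap f a := FirstOrder.Language.Structure.funMap f a
  RelMap {n} p d := (⟨n, p⟩ : RelSym L) ∈ S ∧ FirstOrder.Language.Structure.RelMap p d

/-- Complete models: the restriction to the relations of `NegStar P` is a model of `comp(P⁻)`. If
`NegStar P` is empty, e.g. if `P` is definite, every model of `P` is complete (for Herbrand models
the condition then holds by itself). -/
def IsCompleteModel [L.Structure D] (P : Program L) : Prop :=
  IsModel D P ∧
    ((NegStar P).Nonempty → @IsModelComp L D (restrict D (NegStar P)) (negPart P))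

end Models

/-! ### Level mappings -/

section Levels

variable {L : FirstOrder.Language.{u, v}}

/-- Level mappings: functions from ground atoms to natural numbers. -/
abbrev LevelMapping (L : FirstOrder.Language.{u, v}) := Atom L Empty → ℕ

/-- The level of a ground literal, with `|¬A| = |A|`. -/
def LevelMapping.lit (lev : LevelMapping L) (l : Literal L Empty) : ℕ := lev l.atom

/-- `P` is acceptable with respect to `lev` and the structure on `D`: for every ground instance
`A ← As, B, Bs` of a clause of `P`, if `As` is true in the structure then `|A| > |B|`. -/
def Acceptable (D : Type w) [L.Structure D] (P : Program L) (lev : LevelMapping L) : Prop :=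
  ∀ c ∈ P, ∀ γ : ℕ → L.Term Empty, ∀ (As : Query L) (B : Literal L ℕ) (Bs : Query L),
    c.body = As ++ B :: Bs →
      (∀ l ∈ As, (l.subst γ).Realize (Empty.elim : Empty → D)) →
        lev.lit (B.subst γ) < lev (c.head.subst γ)

/-- The levels of the ground instances of `A` form a finite set. -/
def Bounded (lev : LevelMapping L) (A : Atom L ℕ) : Prop :=
  (Set.range fun γ : ℕ → L.Term Empty => lev (A.subst γ)).Finite

end Levels

end LP

namespace LP

universe u v w

variable {L : FirstOrder.Language.{u, v}}

open FirstOrder.Language (Term)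

/-! ### Terms and substitutions -/

section Substitution

variable {α β γ : Type} {D : Type w} [L.Structure D]

/-! Termination is treated as accessibility for `Move`, which includes the calls of subsidiary
trees, so that nested negation needs no separate measure. A query `l :: T` terminates if `[l]` does
and if every instance `Tσ` left by a refutation of `[l]` does (`Terminates.append`). All these
queries stay in the closed class, and `Tσ` is shorter than `l :: T`; hence it is enough to treat
single literals (`terminates_of_head_terminates`). A literal `¬A` reduces to `A`, since its only
moves call the tree of `A` or leave the empty query. If the relation of `A` is not defined in `P`,
no clause of `P` is ever reached from `A`, and the computation is one of `R` alone
(`Extends.terminates`). Otherwise the ground instances of `A` have levels at most some `N`, and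
strong induction on `N` applies (`terminates_of_level_le`). A resolvent of `A` is an instance of the
body of a clause of `P`; by acceptability each of its literals has levels below `N` on those ground
instances for which the preceding literals are true in the model. When such a literal is reached,
the preceding ones have been refuted, and by soundness (`Refutes.realize`) their computed instances
are true. The delicate point is the soundness of negation as failure in a complete model that need
not be Herbrand (`FinTree.sound`): a query over `NegStar` with a true instance must have a resolvent
with a true instance. This uses the only-if half of the completion, and the fact that equations
solvable in a structure with free equality have an mgu through which the solution factors
(`FreeEquality.hasMGU`). -/

theorem term_subst_subst (t : L.Term α) (σ : α → L.Term β) (τ : β → L.Term γ) :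
    (t.subst σ).subst τ = t.subst fun x => (σ x).subst τ := by
  induction t with
  | var => rfl
  | func f ts ih => simp [Term.subst, ih]

theorem term_subst_var (t : L.Term α) : t.subst (Term.var : α → L.Term α) = t := by
  induction t with
  | var => rfl
  | func f ts ih => simp [Term.subst, ih]

theorem term_subst_congr [DecidableEq α] {t : L.Term α} {σ τ : α → L.Term β}
    (h : ∀ x ∈ t.varFinset, σ x = τ x) : t.subst σ = t.subst τ := by
  induction t with
  | var x => exact h x (by simp [Term.varFinset])
  | func f ts ih =>
    simp only [Term.subst, Term.func.injEq, heq_eq_eq, true_and]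
    funext i
    exact ih i fun x hx => h x (by
      simp only [Term.varFinset, Finset.mem_biUnion, Finset.mem_univ, true_and]; exact ⟨i, hx⟩)

theorem term_realize_congr [DecidableEq α] {t : L.Term α} {x y : α → D}
    (h : ∀ a ∈ t.varFinset, x a = y a) : t.realize x = t.realize y := by
  induction t with
  | var a => exact h a (by simp [Term.varFinset])
  | func f ts ih =>
    simp only [Term.realize]
    congr 1
    funext i
    exact ih i fun a ha => h a (by
      simp only [Term.varFinset, Finset.mem_biUnion, Finset.mem_univ, true_and]; exact ⟨i, ha⟩)

theorem mem_varFinset_subst [DecidableEq α] [DecidableEq β] {t : L.Term α} {σ : α → L.Term β}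
    {y : β} : y ∈ (t.subst σ).varFinset ↔ ∃ x ∈ t.varFinset, y ∈ (σ x).varFinset := by
  induction t with
  | var x => simp [Term.subst, Term.varFinset]
  | func f ts ih =>
    simp only [Term.subst, Term.varFinset, Finset.mem_biUnion, Finset.mem_univ, true_and, ih]
    constructor
    · rintro ⟨i, x, hx, hy⟩
      exact ⟨x, ⟨i, hx⟩, hy⟩
    · rintro ⟨x, ⟨i, hx⟩, hy⟩
      exact ⟨i, x, hx, hy⟩

theorem Atom.subst_subst (A : Atom L α) (σ : α → L.Term β) (τ : β → L.Term γ) :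
    (A.subst σ).subst τ = A.subst fun x => (σ x).subst τ := by
  simp [Atom.subst, term_subst_subst]

theorem Literal.subst_subst (l : Literal L α) (σ : α → L.Term β) (τ : β → L.Term γ) :
    (l.subst σ).subst τ = l.subst fun x => (σ x).subst τ := by
  cases l <;> simp [Literal.subst, Atom.subst_subst]

theorem Literal.atom_subst (l : Literal L α) (σ : α → L.Term β) :
    (l.subst σ).atom = l.atom.subst σ := by
  cases l <;> rfl

theorem Literal.rel_subst (l : Literal L α) (σ : α → L.Term β) : (l.subst σ).rel = l.rel := by
  cases l <;> rfl

theorem Query.subst_subst (Q : Query L) (σ τ : ℕ → L.Term ℕ) :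
    Query.subst (Query.subst Q σ) τ = Query.subst Q fun x => (σ x).subst τ := by
  simp [Query.subst, Literal.subst_subst]

theorem Query.subst_append (Q T : Query L) (σ : ℕ → L.Term ℕ) :
    Query.subst (Q ++ T) σ = Query.subst Q σ ++ Query.subst T σ :=
  List.map_append

theorem Query.subst_var (Q : Query L) : Query.subst Q (Term.var : ℕ → L.Term ℕ) = Q := by
  have : ∀ l : Literal L ℕ, l.subst (Term.var : ℕ → L.Term ℕ) = l := by
    rintro (A | A) <;> simp [Literal.subst, Atom.subst, term_subst_var]
  simp [Query.subst, this]

theorem Atom.realize_subst (A : Atom L α) (σ : α → L.Term β) (x : β → D) :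
    (A.subst σ).Realize x ↔ A.Realize fun a => (σ a).realize x := by
  simp [Atom.Realize, Atom.subst]

theorem Literal.realize_subst (l : Literal L α) (σ : α → L.Term β) (x : β → D) :
    (l.subst σ).Realize x ↔ l.Realize fun a => (σ a).realize x := by
  cases l <;> simp [Literal.Realize, Literal.subst, Atom.realize_subst]

theorem Query.realize_subst (Q : Query L) (σ : ℕ → L.Term ℕ) (x : ℕ → D) :
    (∀ l ∈ Query.subst Q σ, l.Realize x) ↔ ∀ l ∈ Q, l.Realize fun a => (σ a).realize x := by
  simp [Query.subst, Literal.realize_subst]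

theorem Atom.realize_congr {A : Atom L ℕ} {x y : ℕ → D} (h : ∀ a ∈ A.vars, x a = y a) :
    A.Realize x ↔ A.Realize y := by
  unfold Atom.Realize
  rw [show (fun i => (A.args i).realize x) = fun i => (A.args i).realize y from
    funext fun i => term_realize_congr fun a ha => h a ⟨i, ha⟩]

theorem Literal.realize_congr {l : Literal L ℕ} {x y : ℕ → D}
    (h : ∀ a ∈ l.atom.vars, x a = y a) : l.Realize x ↔ l.Realize y := by
  cases l with
  | pos A => exact Atom.realize_congr h
  | neg A => exact not_congr (Atom.realize_congr h)

theorem Query.realize_congr {Q : Query L} {x y : ℕ → D} (h : ∀ a ∈ Query.vars Q, x a = y a) :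
    (∀ l ∈ Q, l.Realize x) ↔ ∀ l ∈ Q, l.Realize y :=
  forall₂_congr fun l hl => Literal.realize_congr fun a ha => h a ⟨l, hl, ha⟩

/-! ### Finiteness of variable sets and standardizing apart. -/

theorem Atom.vars_finite (A : Atom L ℕ) : A.vars.Finite := by
  have : A.vars = ⋃ i, ((A.args i).varFinset : Set ℕ) := by
    ext; simp [Atom.vars]
  rw [this]
  exact Set.finite_iUnion fun i => Finset.finite_toSet _

theorem Query.vars_finite (Q : Query L) : (Query.vars Q).Finite := by
  have : Query.vars Q = ⋃ l ∈ {l | l ∈ Q}, l.atom.vars := by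
    ext; simp [Query.vars]
  rw [this]
  exact (List.finite_toSet Q).biUnion fun l _ => l.atom.vars_finite

theorem Clause.vars_finite (c : Clause L) : c.vars.Finite :=
  c.head.vars_finite.union (Query.vars_finite _)

theorem substVars_finite {θ : ℕ → L.Term ℕ} (h : (substDom θ).Finite) : (substVars θ).Finite := by
  have : {y | ∃ x ∈ substDom θ, y ∈ (θ x).varFinset} =
      ⋃ x ∈ substDom θ, ((θ x).varFinset : Set ℕ) := by
    ext; simp
  unfold substVars
  rw [this]
  exact h.union (h.biUnion fun x _ => Finset.finite_toSet _)

theorem mem_atom_vars_subst {A : Atom L ℕ} {θ : ℕ → L.Term ℕ} {y : ℕ} :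
    y ∈ (A.subst θ).vars ↔ ∃ x ∈ A.vars, y ∈ (θ x).varFinset := by
  simp only [Atom.vars, Atom.subst, Set.mem_ofPred_eq, mem_varFinset_subst]
  constructor
  · rintro ⟨i, x, hx, hy⟩
    exact ⟨x, ⟨i, hx⟩, hy⟩
  · rintro ⟨x, ⟨i, hx⟩, hy⟩
    exact ⟨i, x, hx, hy⟩

theorem mem_query_vars_subst {Q : Query L} {θ : ℕ → L.Term ℕ} {y : ℕ} :
    y ∈ Query.vars (Query.subst Q θ) ↔ ∃ x ∈ Query.vars Q, y ∈ (θ x).varFinset := by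
  constructor
  · rintro ⟨l, hl, hy⟩
    obtain ⟨l, hl', rfl⟩ := List.mem_map.1 hl
    rw [Literal.atom_subst, mem_atom_vars_subst] at hy
    obtain ⟨x, hx, hy⟩ := hy
    exact ⟨x, ⟨l, hl', hx⟩, hy⟩
  · rintro ⟨x, ⟨l, hl, hx⟩, hy⟩
    refine ⟨l.subst θ, List.mem_map.2 ⟨l, hl, rfl⟩, ?_⟩
    rw [Literal.atom_subst, mem_atom_vars_subst]
    exact ⟨x, hx, hy⟩

theorem query_vars_subst_subset (Q : Query L) (θ : ℕ → L.Term ℕ) :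
    Query.vars (Query.subst Q θ) ⊆ Query.vars Q ∪ substVars θ := by
  intro y hy
  obtain ⟨x, hx, hy⟩ := mem_query_vars_subst.1 hy
  by_cases h : θ x = Term.var x
  · rw [h] at hy
    obtain rfl : y = x := by simpa [Term.varFinset] using hy
    exact Or.inl hx
  · exact Or.inr (Or.inr ⟨x, h, hy⟩)

theorem query_vars_append (Q T : Query L) :
    Query.vars (Q ++ T) = Query.vars Q ∪ Query.vars T := by
  ext; simp [Query.vars, or_and_right, exists_or]

theorem query_vars_cons (l : Literal L ℕ) (T : Query L) :
    Query.vars (l :: T) = l.atom.vars ∪ Query.vars T := by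
  ext; simp [Query.vars]

/-- A clause has a variant that avoids a given finite set of variables. -/
theorem Clause.exists_rename_disjoint (c : Clause L) {V : Set ℕ} (hV : V.Finite) :
    ∃ ρ : Equiv.Perm ℕ, Disjoint (c.rename ρ).vars V := by
  obtain ⟨ρ, hρ⟩ : ∃ ρ : Equiv.Perm ℕ, ∀ x ∈ c.vars, ρ x ∉ V := by
    obtain ⟨M, hM⟩ := (c.vars_finite.union hV).bddAbove
    have hM' : ∀ x ∈ c.vars ∪ V, x ≤ M := fun x hx => hM hx
    -- The involution swaps the block `0..M` with the block `M+1..2M+1`; both the clause and `V`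
    -- live in the first block.
    have hinv : Function.Involutive fun x : ℕ =>
        if x ≤ M then x + (M + 1) else if x ≤ 2 * M + 1 then x - (M + 1) else x := by
      intro x
      dsimp only
      split_ifs <;> omega
    refine ⟨hinv.toPerm, fun x hx hV => ?_⟩
    have h1 := hM' x (Or.inl hx)
    have h2 := hM' _ (Or.inr hV)
    simp only [Function.Involutive.coe_toPerm, if_pos h1] at h2
    omega
  refine ⟨ρ, Set.disjoint_left.2 fun y hy hyV => ?_⟩
  have : ∃ x ∈ c.vars, y ∈ (Term.var (ρ x) : L.Term ℕ).varFinset := by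
    rcases hy with hy | hy
    · obtain ⟨x, hx, hy⟩ := mem_atom_vars_subst.1 hy
      exact ⟨x, Or.inl hx, hy⟩
    · obtain ⟨x, hx, hy⟩ := mem_query_vars_subst.1 hy
      exact ⟨x, Or.inr hx, hy⟩
  obtain ⟨x, hx, hy⟩ := this
  obtain rfl : y = ρ x := by simpa [Term.varFinset] using hy
  exact hρ x hx hyV

end Substitution

/-! ### Unification -/

section Unification

def termSize : L.Term ℕ → ℕ
  | .var _ => 1
  | .func _ ts => 1 + ∑ i, termSize (ts i)

def IsUnifier (σ : ℕ → L.Term ℕ) (E : List (L.Term ℕ × L.Term ℕ)) : Prop :=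
  ∀ e ∈ E, e.1.subst σ = e.2.subst σ

variable {D : Type w} [L.Structure D]

/-- `E` has an idempotent most general unifier through which the assignment `x` factors. -/
def HasMGU (x : ℕ → D) (E : List (L.Term ℕ × L.Term ℕ)) : Prop :=
  ∃ θ : ℕ → L.Term ℕ, (substDom θ).Finite ∧ IsUnifier θ E ∧
    (∀ σ, IsUnifier σ E → ∀ y, σ y = (θ y).subst σ) ∧ ∀ y, x y = (θ y).realize x

theorem HasMGU.congr {x : ℕ → D} {E F : List (L.Term ℕ × L.Term ℕ)} (h : HasMGU x E)
    (hEF : ∀ σ, IsUnifier σ E ↔ IsUnifier σ F) : HasMGU x F := by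
  obtain ⟨θ, h1, h2, h3, h4⟩ := h
  exact ⟨θ, h1, (hEF θ).1 h2, fun σ hσ => h3 σ ((hEF σ).2 hσ), h4⟩

theorem HasMGU.nil (x : ℕ → D) : HasMGU (L := L) x [] := by
  refine ⟨Term.var, ?_, by simp [IsUnifier], fun σ _ y => rfl, fun y => rfl⟩
  simp [substDom]

theorem term_subst_update {y : ℕ} {s : L.Term ℕ} (hy : y ∉ s.varFinset) :
    s.subst (Function.update Term.var y s) = s := by
  conv_rhs => rw [← term_subst_var s]
  refine term_subst_congr fun z hz => Function.update_of_ne ?_ _ _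
  rintro rfl
  exact hy hz

/-- Elimination of a variable. -/
theorem HasMGU.elim {x : ℕ → D} {y : ℕ} {s : L.Term ℕ} {E : List (L.Term ℕ × L.Term ℕ)}
    (hy : y ∉ s.varFinset) (hx : x y = s.realize x)
    (h : HasMGU x (E.map fun e => (e.1.subst (Function.update Term.var y s),
      e.2.subst (Function.update Term.var y s)))) :
    HasMGU x ((Term.var y, s) :: E) := by
  set η : ℕ → L.Term ℕ := Function.update Term.var y s with hη
  have hηy : η y = s := by simp [hη]
  have hηz : ∀ z, z ≠ y → η z = Term.var z := fun z hz => by simp [hη, hz]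
  obtain ⟨θ, h1, h2, h3, h4⟩ := h
  refine ⟨fun z => (η z).subst θ, (h1.insert y).subset ?_, ?_, ?_, ?_⟩
  · intro z hz
    by_cases hzy : z = y
    · exact Or.inl hzy
    · refine Or.inr fun h => hz ?_
      simp [hηz z hzy, Term.subst, h]
  · intro e he
    rcases List.mem_cons.1 he with rfl | he
    · rw [← term_subst_subst, ← term_subst_subst]
      simp [Term.subst, hη, term_subst_update hy]
    · rw [← term_subst_subst, ← term_subst_subst]
      exact h2 _ (List.mem_map.2 ⟨e, he, rfl⟩)
  · intro σ hσ
    -- A unifier of `y = s` absorbs the elimination `η`, as it already gives `y` and `s` the same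
    -- value; so it also unifies the reduced system.
    have hση : (fun z => (η z).subst σ) = σ := by
      funext z
      by_cases hzy : z = y
      · subst hzy
        rw [hηy]
        exact (hσ _ List.mem_cons_self).symm
      · simp [hηz z hzy, Term.subst]
    have hu := h3 σ (by
      intro e he
      obtain ⟨e, he', rfl⟩ := List.mem_map.1 he
      simp only [term_subst_subst, hση]
      exact hσ e (List.mem_cons_of_mem _ he'))
    intro z
    rw [term_subst_subst, ← funext hu]
    exact (congrFun hση z).symm
  · intro z
    have : (fun a => (θ a).realize x) = x := funext fun a => (h4 a).symm
    rw [FirstOrder.Language.Term.realize_subst, this]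
    by_cases hzy : z = y
    · subst hzy
      rw [hηy, hx]
    · rw [hηz z hzy]; rfl

/-- The occurs check: it cannot fail on an equation that holds in the structure, because of
acyclicity. -/
theorem FreeEquality.notMem_varFinset (hD : FreeEquality L D) {x : ℕ → D} {y : ℕ} {s : L.Term ℕ}
    (hx : x y = s.realize x) (hs : s ≠ Term.var y) : y ∉ s.varFinset :=
  fun hy => hD.acyclic s y hy hs x hx.symm

theorem varFinset_subst_update_subset {S : Finset ℕ} {y : ℕ} {s t : L.Term ℕ}
    (hy : y ∉ s.varFinset) (hs : s.varFinset ⊆ S) (ht : t.varFinset ⊆ S) :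
    (t.subst (Function.update Term.var y s)).varFinset ⊆ S.erase y := by
  intro z hz
  obtain ⟨a, ha, hz⟩ := mem_varFinset_subst.1 hz
  by_cases hay : a = y
  · subst hay
    rw [Function.update_self] at hz
    exact Finset.mem_erase.2 ⟨fun h => hy (h ▸ hz), hs hz⟩
  · rw [Function.update_of_ne hay] at hz
    obtain rfl : z = a := by simpa [Term.varFinset] using hz
    exact Finset.mem_erase.2 ⟨hay, ht ha⟩

/-- A system of equations that has a solution in a structure satisfying the free equality axioms
is unifiable. -/
theorem FreeEquality.hasMGU (hD : FreeEquality L D) (x : ℕ → D) (S : Finset ℕ)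
    (E : List (L.Term ℕ × L.Term ℕ))
    (hS : ∀ e ∈ E, e.1.varFinset ⊆ S ∧ e.2.varFinset ⊆ S)
    (hE : ∀ e ∈ E, e.1.realize x = e.2.realize x) : HasMGU x E := by
  -- The unification algorithm with a lexicographic measure: eliminating a variable shrinks `S`,
  -- while deletion and decomposition keep `S` and decrease the total term size.
  induction S using Finset.strongInduction generalizing E with
  | H S ihS =>
  have elim : ∀ (y : ℕ) (s : L.Term ℕ) (E : List (L.Term ℕ × L.Term ℕ)),
      y ∈ S → s.varFinset ⊆ S → (∀ e ∈ E, e.1.varFinset ⊆ S ∧ e.2.varFinset ⊆ S) →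
      (∀ e ∈ E, e.1.realize x = e.2.realize x) → x y = s.realize x → s ≠ Term.var y →
      HasMGU x ((Term.var y, s) :: E) := by
    intro y s E hyS hsS hS hE hx hs
    have hy := hD.notMem_varFinset hx hs
    refine HasMGU.elim hy hx (ihS _ (Finset.erase_ssubset hyS) _ ?_ ?_)
    · intro e he
      obtain ⟨e, he', rfl⟩ := List.mem_map.1 he
      exact ⟨varFinset_subst_update_subset hy hsS (hS e he').1,
        varFinset_subst_update_subset hy hsS (hS e he').2⟩
    · intro e he
      obtain ⟨e, he', rfl⟩ := List.mem_map.1 he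
      have : (fun a => ((Function.update Term.var y s : ℕ → L.Term ℕ) a).realize x) = x := by
        funext a
        by_cases hay : a = y
        · subst hay; simp [hx]
        · simp [hay]
      simpa [FirstOrder.Language.Term.realize_subst, this] using hE e he'
  induction hm : (E.map fun e => termSize e.1 + termSize e.2).sum using Nat.strong_induction_on
    generalizing E with
  | _ m ihm =>
  subst hm
  match E, hS, hE, ihm with
  | [], _, _, _ => exact HasMGU.nil x
  | (t, s) :: E, hS, hE, ihm =>
    have hSE := fun e he => hS e (List.mem_cons_of_mem _ he)
    have hEE := fun e he => hE e (List.mem_cons_of_mem _ he)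
    obtain ⟨htS, hsS⟩ := hS _ List.mem_cons_self
    have hts := hE _ List.mem_cons_self
    simp only at htS hsS hts
    match t, s, htS, hsS, hts, ihm with
    | .var y, s, htS, hsS, hts, ihm =>
      have hyS : y ∈ S := htS (by simp [Term.varFinset])
      by_cases hs : s = Term.var y
      · subst hs
        refine HasMGU.congr (ihm _ ?_ E hSE hEE rfl) ?_
        · simp [termSize]
        · simp [IsUnifier]
      · exact elim y s E hyS hsS hSE hEE hts hs
    | .func f ts, .var y, htS, hsS, hts, ihm =>
      have hyS : y ∈ S := hsS (by simp [Term.varFinset])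
      refine HasMGU.congr (elim y _ E hyS htS hSE hEE hts.symm (by simp)) ?_
      intro σ
      simp only [IsUnifier, List.forall_mem_cons, eq_comm]
    | .func (l := m) f ts, .func (l := n) g ss, htS, hsS, hts, ihm =>
      -- No clash of function symbols is possible, since both sides have the same value in the
      -- structure.
      have hfg : (⟨m, f⟩ : Σ k, L.Functions k) = ⟨n, g⟩ := by
        by_contra h
        exact hD.ne m n f g _ _ h hts
      cases hfg
      have hinj := hD.inj _ f _ _ hts
      refine HasMGU.congr (ihm _ ?_ ((List.ofFn fun i => (ts i, ss i)) ++ E) ?_ ?_ rfl) ?_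
      · simp only [List.map_append, List.map_ofFn, List.sum_append, List.sum_ofFn, List.map_cons,
          List.sum_cons, termSize, Function.comp_def, Finset.sum_add_distrib]
        omega
      · intro e he
        rcases List.mem_append.1 he with he | he
        · obtain ⟨i, rfl⟩ := List.mem_ofFn.1 he
          refine ⟨fun z hz => htS ?_, fun z hz => hsS ?_⟩ <;>
          · simp only [Term.varFinset, Finset.mem_biUnion, Finset.mem_univ, true_and]
            exact ⟨i, hz⟩
        · exact hSE e he
      · intro e he
        rcases List.mem_append.1 he with he | he
        · obtain ⟨i, rfl⟩ := List.mem_ofFn.1 he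
          exact congrFun hinj i
        · exact hEE e he
      · intro σ
        simp only [IsUnifier, List.forall_mem_cons, List.forall_mem_append, List.forall_mem_ofFn_iff,
          Term.subst, Term.func.injEq, heq_eq_eq, true_and, funext_iff]

/-- Atoms that agree under an assignment in a structure satisfying the free equality axioms have a
most general unifier through which the assignment factors. -/
theorem FreeEquality.exists_isMGU (hD : FreeEquality L D) (x : ℕ → D) (p : RelSym L)
    (ts ss : Fin p.1 → L.Term ℕ) (h : ∀ i, (ts i).realize x = (ss i).realize x) :
    ∃ θ, IsMGU θ ⟨p, ts⟩ ⟨p, ss⟩ ∧ ∀ y, x y = (θ y).realize x := by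
  obtain ⟨θ, h1, h2, h3, h4⟩ := hD.hasMGU x
    (Finset.univ.biUnion fun i => (ts i).varFinset ∪ (ss i).varFinset)
    (List.ofFn fun i => (ts i, ss i))
    (by
      intro e he
      obtain ⟨i, rfl⟩ := List.mem_ofFn.1 he
      constructor <;> intro z hz <;>
        simp only [Finset.mem_biUnion, Finset.mem_univ, true_and, Finset.mem_union]
      · exact ⟨i, Or.inl hz⟩
      · exact ⟨i, Or.inr hz⟩)
    (by
      intro e he
      obtain ⟨i, rfl⟩ := List.mem_ofFn.1 he
      exact h i)
  have key : ∀ σ : ℕ → L.Term ℕ, (⟨p, ts⟩ : Atom L ℕ).subst σ = (⟨p, ss⟩ : Atom L ℕ).subst σ ↔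
      IsUnifier σ (List.ofFn fun i => (ts i, ss i)) := by
    intro σ
    simp [Atom.subst, IsUnifier, funext_iff]
  exact ⟨θ, ⟨h1, (key θ).2 h2, fun σ hσ => ⟨σ, h3 σ ((key σ).1 hσ)⟩⟩, h4⟩

end Unification

/-! ### Variables along derivations -/

section Used

variable {G : Program L} {s t : Node L}

theorem Resolves.vars_subset (h : Resolves G s t) (hs : Query.vars s.query ⊆ s.used) :
    Query.vars t.query ⊆ t.used := by
  cases h with
  | intro V A T c hc ρ hρ θ hθ =>
    refine (query_vars_subst_subset _ θ).trans (Set.union_subset_union_left _ ?_)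
    rw [query_vars_append]
    refine Set.union_subset ?_ ?_
    · exact fun y hy => Or.inr (Or.inr hy)
    · intro y hy
      refine Or.inl (hs ?_)
      rw [query_vars_cons]
      exact Or.inr hy

theorem Resolves.used_finite (h : Resolves G s t) (hs : s.used.Finite) : t.used.Finite := by
  cases h with
  | intro V A T c hc ρ hρ θ hθ =>
    exact (hs.union (Clause.vars_finite _)).union (substVars_finite hθ.1)

theorem Move.vars_subset (h : Move G s t) (hs : Query.vars s.query ⊆ s.used) :
    Query.vars t.query ⊆ t.used := by
  cases h with
  | resolve _ _ h => exact h.vars_subset hs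
  | call => exact subset_rfl
  | naf V A T hA h =>
    refine subset_trans ?_ hs
    simp only [query_vars_cons]
    exact Set.subset_union_right

theorem vars_subset_of_moves (h : Relation.ReflTransGen (Move G) s t)
    (hs : Query.vars s.query ⊆ s.used) : Query.vars t.query ⊆ t.used := by
  induction h with
  | refl => exact hs
  | tail _ h ih => exact h.vars_subset ih

/-- A move remains possible if fewer variables have been used. -/
theorem Move.exists_of_subset {V : Set ℕ} (h : Move G s t) (hV : V ⊆ s.used) :
    ∃ W ⊆ t.used, Move G ⟨V, s.query⟩ ⟨W, t.query⟩ := by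
  cases h with
  | resolve _ _ h =>
    cases h with
    | intro V' A T c hc ρ hρ θ hθ =>
      exact ⟨V ∪ (c.rename ρ).vars ∪ substVars θ,
        Set.union_subset_union_left _ (Set.union_subset_union_left _ hV),
        .resolve _ _ (.intro V A T c hc ρ (hρ.mono_right hV) θ hθ)⟩
  | call V' A T hA => exact ⟨_, subset_rfl, .call V A T hA⟩
  | naf V' A T hA h => exact ⟨V, hV, .naf V A T hA h⟩

theorem moves_exists_of_subset {V : Set ℕ} (h : Relation.ReflTransGen (Move G) s t)
    (hV : V ⊆ s.used) :
    ∃ W ⊆ t.used, Relation.ReflTransGen (Move G) ⟨V, s.query⟩ ⟨W, t.query⟩ := by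
  induction h with
  | refl => exact ⟨V, hV, .refl⟩
  | tail _ h ih =>
    obtain ⟨W, hW, hm⟩ := ih
    obtain ⟨W', hW', h'⟩ := h.exists_of_subset hW
    exact ⟨W', hW', hm.tail h'⟩

end Used

/-! ### Complete models -/

section Models

variable {D : Type w} [L.Structure D] {G : Program L}

theorem realize_restrict (S : Set (RelSym L)) (t : L.Term ℕ) (x : ℕ → D) :
    @Term.realize L D (restrict D S) ℕ x t = t.realize x := by
  induction t with
  | var => rfl
  | func f ts ih =>
    simp only [Term.realize, ih]
    rfl

theorem Atom.realize_restrict {S : Set (RelSym L)} {A : Atom L ℕ} (hA : A.rel ∈ S) (x : ℕ → D) :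
    @Atom.Realize L ℕ D (restrict D S) A x ↔ A.Realize x := by
  simp only [Atom.Realize, LP.realize_restrict]
  exact and_iff_right hA

theorem Literal.realize_restrict {S : Set (RelSym L)} {l : Literal L ℕ} (hl : l.rel ∈ S)
    (x : ℕ → D) : @Literal.Realize L ℕ D (restrict D S) l x ↔ l.Realize x := by
  cases l with
  | pos A => exact Atom.realize_restrict hl x
  | neg A => exact not_congr (Atom.realize_restrict hl x)

theorem freeEquality_of_restrict {S : Set (RelSym L)}
    (h : @FreeEquality L D (restrict D S)) : FreeEquality L D where
  inj := @FreeEquality.inj L D (restrict D S) h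
  ne := @FreeEquality.ne L D (restrict D S) h
  acyclic t y hy ht x := by
    have := @FreeEquality.acyclic L D (restrict D S) h t y hy ht x
    rwa [LP.realize_restrict] at this

theorem rel_mem_negStar_of_mem_body {c : Clause L} (hc : c ∈ G) (h : c.head.rel ∈ NegStar G)
    {l : Literal L ℕ} (hl : l ∈ c.body) : l.rel ∈ NegStar G := by
  obtain ⟨p, hp, hd⟩ := h
  exact ⟨p, hp, hd.tail ⟨c, hc, rfl, l, hl, rfl⟩⟩

theorem neg_subset_negStar : Neg G ⊆ NegStar G := fun p hp => ⟨p, hp, .refl⟩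

theorem IsCompleteModel.freeEquality (hM : IsCompleteModel D G) (h : (NegStar G).Nonempty) :
    FreeEquality L D :=
  freeEquality_of_restrict (hM.2 h).1

/-- In a complete model, the relations of `NegStar G` satisfy the only-if half of their completed
definitions. -/
theorem IsCompleteModel.exists_clause (hM : IsCompleteModel D G) {p : RelSym L}
    (hp : p ∈ NegStar G) {d : Fin p.1 → D} (h : FirstOrder.Language.Structure.RelMap p.2 d) :
    ∃ c ∈ G, ∃ ts : Fin p.1 → L.Term ℕ, c.head = ⟨p, ts⟩ ∧
      ∃ x : ℕ → D, (∀ i, d i = (ts i).realize x) ∧ ∀ l ∈ c.body, l.Realize x := by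
  obtain ⟨c, hc, ts, hts, x, hx, hb⟩ := ((hM.2 ⟨p, hp⟩).2 p d).1 ⟨hp, h⟩
  refine ⟨c, hc.1, ts, hts, x, fun i => ?_, fun l hl => ?_⟩
  · rw [hx i, LP.realize_restrict]
  · exact (Literal.realize_restrict (rel_mem_negStar_of_mem_body hc.1 hc.2 hl) x).1 (hb l hl)

theorem Clause.rel_of_mem_rename_body {c : Clause L} {ρ : Equiv.Perm ℕ} {l : Literal L ℕ}
    (hl : l ∈ (c.rename ρ).body) : ∃ l' ∈ c.body, l'.rel = l.rel := by
  obtain ⟨l', hl', rfl⟩ := List.mem_map.1 hl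
  exact ⟨l', hl', (Literal.rel_subst _ _).symm⟩

theorem IsMGU.rel_eq {θ : ℕ → L.Term ℕ} {A B : Atom L ℕ} (h : IsMGU θ A B) : A.rel = B.rel := by
  have := congrArg Atom.rel h.2.1
  exact this

/-- Truth of a resolvent implies truth of the corresponding instance of the query. -/
theorem IsModel.realize_of_resolvent (hM : IsModel D G) {A : Atom L ℕ} {c : Clause L} (hc : c ∈ G)
    {ρ : Equiv.Perm ℕ} {θ : ℕ → L.Term ℕ} (hθ : IsMGU θ A (c.rename ρ).head) {x : ℕ → D}
    (hx : ∀ l ∈ Query.subst (c.rename ρ).body θ, l.Realize x) :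
    (A.subst θ).Realize x := by
  rw [hθ.2.1, Atom.realize_subst]
  rw [Query.realize_subst] at hx
  change (c.head.subst _).Realize _
  rw [Atom.realize_subst]
  refine hM c hc _ ?_
  exact (Query.realize_subst _ _ _).1 hx

/-- A query of which an instance is true in a complete model has a resolvent that is true under an
assignment that extends the given one. -/
theorem IsCompleteModel.exists_resolves (hM : IsCompleteModel D G) {V : Set ℕ} {A : Atom L ℕ}
    {T : Query L} (hA : A.rel ∈ NegStar G) (hV : V.Finite)
    (hvars : Query.vars (.pos A :: T) ⊆ V) {x : ℕ → D}
    (hx : ∀ l ∈ Literal.pos A :: T, l.Realize x) :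
    ∃ s, Resolves G ⟨V, .pos A :: T⟩ s ∧ ∃ y : ℕ → D, ∀ l ∈ s.query, l.Realize y := by
  obtain ⟨c, hc, ts, hts, z, hz, hb⟩ := hM.exists_clause hA (hx _ List.mem_cons_self)
  obtain ⟨ρ, hρ⟩ := c.exists_rename_disjoint hV
  classical
  -- The solution `x` of the query and the solution `z` of the clause body are glued into one
  -- assignment; standardizing apart makes them compatible.
  let y : ℕ → D := fun a => if a ∈ V then x a else z (ρ.symm a)
  have hyV : ∀ a ∈ V, y a = x a := fun a ha => if_pos ha
  have hyc : ∀ a ∈ c.vars, y (ρ a) = z a := by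
    intro a ha
    have : ρ a ∉ V := by
      refine Set.disjoint_left.1 hρ ?_
      rcases ha with ha | ha
      · exact Or.inl (mem_atom_vars_subst.2 ⟨a, ha, by simp [Term.varFinset]⟩)
      · exact Or.inr (mem_query_vars_subst.2 ⟨a, ha, by simp [Term.varFinset]⟩)
    simp [y, this]
  have hhead : (c.rename ρ).head = ⟨A.rel, fun i => (ts i).subst fun a => Term.var (ρ a)⟩ := by
    change c.head.subst _ = _
    rw [hts]
    rfl
  obtain ⟨θ, hθ, hyθ⟩ := (hM.freeEquality ⟨_, hA⟩).exists_isMGU y A.rel A.args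
    (fun i => (ts i).subst fun a => Term.var (ρ a)) (by
      intro i
      rw [FirstOrder.Language.Term.realize_subst,
        term_realize_congr (t := A.args i) (y := x) fun a ha => hyV a (hvars ⟨_, List.mem_cons_self, i, ha⟩), hz i]
      refine term_realize_congr fun a ha => (hyc a (Or.inl ?_)).symm
      rw [hts]
      exact ⟨i, ha⟩)
  refine ⟨_, .intro V A T c hc ρ hρ θ (by rw [hhead]; exact hθ), y, ?_⟩
  dsimp only
  rw [Query.realize_subst, ← funext hyθ, List.forall_mem_append]
  constructor
  · refine (Query.realize_subst _ _ _).2 ?_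
    exact (Query.realize_congr fun a ha => hyc a (Or.inr ha)).2 hb
  · refine (Query.realize_congr fun a ha => hyV a (hvars ?_)).2
      fun l hl => hx l (List.mem_cons_of_mem _ hl)
    rw [query_vars_cons]
    exact Or.inr ha

theorem Atom.IsGround.realize_iff {A : Atom L ℕ} (hA : A.IsGround) (x y : ℕ → D) :
    A.Realize x ↔ A.Realize y :=
  Atom.realize_congr fun a ha => by
    rw [Atom.IsGround] at hA
    rw [hA] at ha
    exact ha.elim

/-! ### Soundness of negation as failure. -/

theorem Outcome.mem_of_combine_eq_succeeded {S : Set Outcome}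
    (h : Outcome.combine S = .succeeded) : Outcome.succeeded ∈ S := by
  unfold Outcome.combine at h
  split_ifs at h
  assumption

theorem Outcome.eq_failed_of_combine_eq_failed {S : Set Outcome}
    (h : Outcome.combine S = .failed) {o : Outcome} (ho : o ∈ S) : o = .failed := by
  unfold Outcome.combine at h
  split_ifs at h
  cases o <;> first | rfl | contradiction

/-- Soundness of finite LDNF-trees with respect to complete models. -/
theorem FinTree.sound [Nonempty D] (hM : IsCompleteModel D G) {s : Node L} {o : Outcome}
    (h : FinTree G s o) (hfin : s.used.Finite) (hvars : Query.vars s.query ⊆ s.used)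
    (hrel : ∀ l ∈ s.query, l.rel ∈ NegStar G) :
    (o = .failed → ∀ x : ℕ → D, ¬ ∀ l ∈ s.query, l.Realize x) ∧
      (o = .succeeded → ∃ x : ℕ → D, ∀ l ∈ s.query, l.Realize x) := by
  have hroot : ∀ {A : Atom L ℕ} {V : Set ℕ} {T : Query L},
      (∀ l ∈ (Node.mk V (.neg A :: T)).query, l.rel ∈ NegStar G) →
        ∀ l ∈ (Node.root [.pos A]).query, l.rel ∈ NegStar G := by
    intro A V T hrel l hl
    obtain rfl := List.mem_singleton.1 hl
    exact hrel (.neg A) List.mem_cons_self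
  have htail : ∀ {A : Atom L ℕ} {V : Set ℕ} {T : Query L},
      Query.vars (.neg A :: T) ⊆ V → Query.vars T ⊆ V := by
    intro A V T h
    rw [query_vars_cons] at h
    exact Set.subset_union_right.trans h
  -- Both halves are proved together, since they alternate at negative literals: failure of `¬A`
  -- uses success of `A`, and deletion of `¬A` uses failure of `A`. A floundered tree claims
  -- nothing.
  induction h with
  | empty V =>
    exact ⟨nofun, fun _ => ⟨fun _ => Classical.arbitrary D, by simp⟩⟩
  | pos V A T f h ih =>
    have hA : A.rel ∈ NegStar G := hrel (.pos A) List.mem_cons_self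
    have ih' : ∀ s, Resolves G ⟨V, .pos A :: T⟩ s → _ := fun s hs =>
      ih s hs (hs.used_finite hfin) (hs.vars_subset hvars) (by
        cases hs with
        | intro _ _ _ c hc ρ hρ θ hθ =>
          intro l hl
          obtain ⟨l, hl', rfl⟩ := List.mem_map.1 hl
          rw [Literal.rel_subst]
          rcases List.mem_append.1 hl' with hl' | hl'
          · obtain ⟨l', hl', h⟩ := Clause.rel_of_mem_rename_body hl'
            rw [← h]
            refine rel_mem_negStar_of_mem_body hc ?_ hl'
            have := hθ.rel_eq
            rw [this] at hA
            exact hA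
          · exact hrel l (List.mem_cons_of_mem _ hl'))
    constructor
    · intro ho x hx
      obtain ⟨s, hs, y, hy⟩ := hM.exists_resolves hA hfin hvars hx
      exact (ih' s hs).1 (Outcome.eq_failed_of_combine_eq_failed ho ⟨s, hs, rfl⟩) y hy
    · intro ho
      obtain ⟨s, hs, hf⟩ := Outcome.mem_of_combine_eq_succeeded ho
      obtain ⟨y, hy⟩ := (ih' s hs).2 hf.symm
      cases hs with
      | intro _ _ _ c hc ρ hρ θ hθ =>
        dsimp only at hy
        rw [Query.subst_append, List.forall_mem_append] at hy
        refine ⟨fun a => (θ a).realize y, ?_⟩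
        rw [← Query.realize_subst]
        exact List.forall_mem_cons.2 ⟨hM.1.realize_of_resolvent hc hθ hy.1, hy.2⟩
  | negNonground V A T hA => exact ⟨nofun, nofun⟩
  | negSucceeded V A T hA h ih =>
    refine ⟨fun _ x hx => ?_, nofun⟩
    obtain ⟨y, hy⟩ := (ih (Query.vars_finite _) subset_rfl (hroot hrel)).2 rfl
    exact hx (.neg A) List.mem_cons_self
      ((hA.realize_iff y x).1 (hy (.pos A) List.mem_cons_self))
  | negFloundered V A T hA h ih => exact ⟨nofun, nofun⟩
  | negFailed V A T o hA h hT ih ihT =>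
    have hf := (ih (Query.vars_finite _) subset_rfl (hroot hrel)).1 rfl
    have := ihT hfin (htail hvars) fun l hl => hrel l (List.mem_cons_of_mem _ hl)
    refine ⟨fun ho x hx => this.1 ho x fun l hl => hx l (List.mem_cons_of_mem _ hl), fun ho => ?_⟩
    obtain ⟨x, hx⟩ := this.2 ho
    refine ⟨x, List.forall_mem_cons.2 ⟨fun hAx => hf x ?_, hx⟩⟩
    intro l hl
    obtain rfl := List.mem_singleton.1 hl
    exact hAx

theorem FinitelyFailed.not_realize [Nonempty D] (hM : IsCompleteModel D G) {A : Atom L ℕ}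
    (h : FinitelyFailed G [.pos A]) (hA : A.rel ∈ NegStar G) (x : ℕ → D) : ¬ A.Realize x := by
  intro hAx
  refine (FinTree.sound hM h (Query.vars_finite _) subset_rfl ?_).1 rfl x ?_ <;>
  · intro l hl
    obtain rfl := List.mem_singleton.1 hl
    assumption

end Models

/-! ### Termination and refutations -/

section Termination

variable {G : Program L}

/-- There is no infinite sequence of moves from `s`. -/
abbrev Terminates (G : Program L) (s : Node L) : Prop := Acc (fun t s => Move G s t) s

theorem terminates_root_iff {Q : Query L} :
    Terminates G (Node.root Q) ↔ AllDerivationsFinite G Q := by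
  rw [Terminates, acc_iff_isEmpty_descending_chain, AllDerivationsFinite, isEmpty_subtype,
    not_exists]

/-- More used variables leave fewer admissible variants, so each move from the larger node is
matched by one from the smaller node. This is what allows a query met in mid-branch to be restarted
as a root. -/
theorem Terminates.mono {V W : Set ℕ} {Q : Query L} (h : Terminates G ⟨V, Q⟩) (hVW : V ⊆ W) :
    Terminates G ⟨W, Q⟩ := by
  generalize hs : Node.mk V Q = s at h
  induction h generalizing V W Q with
  | intro s _ ih =>
    subst hs
    refine Acc.intro _ fun t ht => ?_
    obtain ⟨V', hV', hm⟩ := ht.exists_of_subset hVW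
    exact ih _ hm hV' rfl

theorem Terminates.of_root {V : Set ℕ} {Q : Query L} (h : Terminates G (Node.root Q))
    (hV : Query.vars Q ⊆ V) : Terminates G ⟨V, Q⟩ :=
  Terminates.mono h hV

theorem terminates_nil (V : Set ℕ) : Terminates G ⟨V, []⟩ := by
  refine Acc.intro _ fun t ht => ?_
  cases ht with
  | resolve _ _ h => cases h

/-- `Refutes G V Q σ W`: the node `⟨V, Q⟩` has a refutation, in which the mgus compose to `σ` and
after which the variables in `W` have been used. -/
inductive Refutes (G : Program L) : Set ℕ → Query L → (ℕ → L.Term ℕ) → Set ℕ → Prop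
  | nil (V : Set ℕ) : Refutes G V [] Term.var V
  | resolve (V : Set ℕ) (A : Atom L ℕ) (T : Query L) (c : Clause L) (hc : c ∈ G)
      (ρ : Equiv.Perm ℕ) (hρ : Disjoint (c.rename ρ).vars V) (θ : ℕ → L.Term ℕ)
      (hθ : IsMGU θ A (c.rename ρ).head) (σ : ℕ → L.Term ℕ) (W : Set ℕ)
      (h : Refutes G (V ∪ (c.rename ρ).vars ∪ substVars θ)
        (Query.subst ((c.rename ρ).body ++ T) θ) σ W) :
      Refutes G V (.pos A :: T) (fun x => (θ x).subst σ) W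
  | naf (V : Set ℕ) (A : Atom L ℕ) (T : Query L) (hA : A.IsGround)
      (hf : FinitelyFailed G [.pos A]) (σ : ℕ → L.Term ℕ) (W : Set ℕ) (h : Refutes G V T σ W) :
      Refutes G V (.neg A :: T) σ W

/-- Moves inspect only the first literal, so a refutation can be replayed in front of `T`, which
merely collects the mgus. -/
theorem Refutes.moves {V W : Set ℕ} {Q : Query L} {σ : ℕ → L.Term ℕ} (h : Refutes G V Q σ W)
    (T : Query L) : Relation.ReflTransGen (Move G) ⟨V, Q ++ T⟩ ⟨W, Query.subst T σ⟩ := by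
  induction h generalizing T with
  | nil V =>
    rw [Query.subst_var]
    exact .refl
  | resolve V A Q c hc ρ hρ θ hθ σ W h ih =>
    refine .head (.resolve _ _ (.intro V A (Q ++ T) c hc ρ hρ θ hθ)) ?_
    have := ih (Query.subst T θ)
    rwa [← Query.subst_append, Query.subst_subst, List.append_assoc] at this
  | naf V A Q hA hf σ W h ih => exact .head (.naf V A (Q ++ T) hA hf) (ih T)

/-- A conjunction terminates if its first part does and every instance of its second part
that is reached by a refutation of the first part does. -/
theorem Terminates.append {V : Set ℕ} {Q T : Query L} (hQ : Terminates G ⟨V, Q⟩)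
    (hT : ∀ σ W, Refutes G V Q σ W → Terminates G ⟨W, Query.subst T σ⟩) :
    Terminates G ⟨V, Q ++ T⟩ := by
  generalize hs : Node.mk V Q = s at hQ
  induction hQ generalizing V Q T with
  | intro s hacc ih =>
    subst hs
    match Q, hT, ih, hacc with
    | [], hT, _, _ =>
      have := hT _ _ (.nil V)
      rwa [Query.subst_var] at this
    | .pos A :: Q, hT, ih, _ =>
      refine Acc.intro _ fun t ht => ?_
      cases ht with
      | resolve _ _ h =>
        cases h with
        | intro _ _ _ c hc ρ hρ θ hθ =>
          change Terminates G ⟨_, Query.subst (_ ++ (Q ++ T)) θ⟩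
          rw [← List.append_assoc, Query.subst_append]
          refine ih _ (.resolve _ _ (.intro V A Q c hc ρ hρ θ hθ)) (fun σ W h => ?_) rfl
          rw [Query.subst_subst]
          exact hT _ _ (.resolve V A Q c hc ρ hρ θ hθ σ W h)
    | .neg A :: Q, hT, ih, hacc =>
      refine Acc.intro _ fun t ht => ?_
      cases ht with
      | resolve _ _ h => cases h
      | call _ _ _ hA => exact hacc _ (.call V A Q hA)
      | naf _ _ _ hA hf =>
        exact ih _ (.naf V A Q hA hf) (fun σ W h => hT _ _ (.naf V A Q hA hf σ W h)) rfl

/-- Soundness of refutations with respect to complete models. -/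
theorem Refutes.realize {D : Type w} [L.Structure D] [Nonempty D] (hM : IsCompleteModel D G)
    {V W : Set ℕ} {Q : Query L} {σ : ℕ → L.Term ℕ} (h : Refutes G V Q σ W)
    (hneg : ∀ A, .neg A ∈ Q → A.rel ∈ Neg G) (x : ℕ → D) :
    ∀ l ∈ Query.subst Q σ, l.Realize x := by
  induction h with
  | nil V => simp [Query.subst]
  | resolve V A T c hc ρ hρ θ hθ σ W h ih =>
    -- Negative literals of the resolvent come from the query or from a clause body, so their
    -- relations stay in `Neg G`. Positive literals need no restriction: there the model property of
    -- the program suffices.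
    have key := ih (by
      intro B hB
      obtain ⟨l, hl, hlB⟩ := List.mem_map.1 hB
      rcases l with l | l
      · cases hlB
      cases hlB
      rcases List.mem_append.1 hl with hl | hl
      · obtain ⟨l', hl', h⟩ := List.mem_map.1 hl
        rcases l' with l' | l'
        · cases h
        cases h
        exact ⟨c, hc, l', hl', rfl⟩
      · exact hneg l (List.mem_cons_of_mem _ hl))
    rw [Query.realize_subst, Query.subst_append, List.forall_mem_append] at key
    rw [← Query.subst_subst, Query.realize_subst]
    exact List.forall_mem_cons.2 ⟨hM.1.realize_of_resolvent hc hθ key.1, key.2⟩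
  | naf V A T hA hf σ W h ih =>
    refine List.forall_mem_cons.2 ⟨?_, ih fun B hB => hneg B (List.mem_cons_of_mem _ hB)⟩
    rw [Literal.realize_subst]
    exact hf.not_realize hM (neg_subset_negStar (hneg A List.mem_cons_self)) _

/-! ### Reduction to single literals in closed classes. -/

variable {C : Set (Query L)}

theorem IsClosedClass.mem_of_moves (hC : IsClosedClass G C) {Q Q' : Query L} (hQ : Q ∈ C)
    {V W : Set ℕ} (hV : Query.vars Q ⊆ V)
    (h : Relation.ReflTransGen (Move G) ⟨V, Q⟩ ⟨W, Q'⟩) : Q' ∈ C := by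
  obtain ⟨W', -, h'⟩ := moves_exists_of_subset h hV
  exact hC.2 Q hQ Q' ⟨W', h'⟩

/-- If the first literals of the queries of a closed class terminate, the queries terminate. The
predicate `I` is an invariant that may be used to establish termination of the literals. -/
theorem terminates_of_head_terminates (hC : IsClosedClass G C) (I : Query L → Prop)
    (hI : ∀ l T V σ W, I (l :: T) → Refutes G V [l] σ W → I (Query.subst T σ))
    (hl : ∀ l T, I (l :: T) → [l] ∈ C → Terminates G (Node.root [l])) (Q : Query L) (hQ : Q ∈ C)
    (hIQ : I Q) : Terminates G (Node.root Q) := by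
  induction hn : Q.length generalizing Q with
  | zero =>
    obtain rfl := List.length_eq_zero_iff.1 hn
    exact terminates_nil _
  | succ n ih =>
    obtain ⟨l, T, rfl⟩ := List.exists_cons_of_length_eq_add_one hn
    have hlC : [l] ∈ C := hC.1 _ hQ [l] (by simp) ⟨T, rfl⟩
    have hvars : Query.vars [l] ⊆ Query.vars (l :: T) := by
      rw [show l :: T = [l] ++ T from rfl, query_vars_append]
      exact Set.subset_union_left
    refine Terminates.append (Q := [l]) ((hl l T hIQ hlC).of_root hvars) fun σ W h => ?_
    have hm := h.moves T
    refine (ih _ (hC.mem_of_moves hQ subset_rfl hm) (hI l T _ σ W hIQ h) ?_).of_root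
      (vars_subset_of_moves hm subset_rfl)
    simpa [Query.subst] using hn

theorem terminates_literal (hC : IsClosedClass G C) {l : Literal L ℕ} (hl : [l] ∈ C)
    (h : [.pos l.atom] ∈ C → Terminates G (Node.root [.pos l.atom])) :
    Terminates G (Node.root [l]) := by
  cases l with
  | pos A => exact h hl
  | neg A =>
    refine Acc.intro _ fun t ht => ?_
    cases ht with
    | resolve _ _ h => cases h
    | call _ _ _ hA => exact h (hC.mem_of_moves hl subset_rfl (.single (.call _ A [] hA)))
    | naf _ _ _ hA hf => exact terminates_nil _

end Termination

/-! ### Extensions of programs -/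

section Extensions

variable {P R : Program L}

theorem Resolves.mono {G H : Program L} (hGH : G ⊆ H) {s t : Node L} (h : Resolves G s t) :
    Resolves H s t := by
  cases h with
  | intro V A T c hc ρ hρ θ hθ => exact .intro V A T c (hGH hc) ρ hρ θ hθ

/-- No relation of the query is defined in `P`. -/
def Undefined (P : Program L) (Q : Query L) : Prop := ∀ l ∈ Q, ¬ DefinedIn P l.rel

theorem Extends.resolves (hext : Extends P R) {s t : Node L} (hs : Undefined P s.query)
    (h : Resolves (P ∪ R) s t) : Resolves R s t ∧ Undefined P t.query := by
  cases h with
  | intro V A T c hc ρ hρ θ hθ =>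
    have hrel : A.rel = c.head.rel := hθ.rel_eq
    have hcR : c ∈ R := hc.resolve_left fun hcP =>
      hs (.pos A) List.mem_cons_self ⟨c, hcP, hrel.symm⟩
    refine ⟨.intro V A T c hcR ρ hρ θ hθ, fun l hl => ?_⟩
    obtain ⟨l, hl', rfl⟩ := List.mem_map.1 hl
    rw [Literal.rel_subst]
    rcases List.mem_append.1 hl' with hl' | hl'
    · obtain ⟨l', hl', h⟩ := Clause.rel_of_mem_rename_body hl'
      exact fun hd => hext _ hd ⟨c, hcR, Or.inr ⟨l', hl', h⟩⟩
    · exact hs l (List.mem_cons_of_mem _ hl')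

theorem Undefined.tail {l : Literal L ℕ} {T : Query L} (h : Undefined P (l :: T)) :
    Undefined P T := fun l' hl' => h l' (List.mem_cons_of_mem _ hl')

theorem Undefined.pos_of_neg {A : Atom L ℕ} {T : Query L} (h : Undefined P (.neg A :: T)) :
    Undefined P [.pos A] := by
  intro l hl
  obtain rfl := List.mem_singleton.1 hl
  exact h (.neg A) List.mem_cons_self

/-- On such a query both programs have the same resolvents, so the outcomes combined at each node
agree. This is needed to transfer deletions of negative literals, which depend on whole subsidiary
trees. -/
theorem Extends.finTree (hext : Extends P R) {s : Node L} {o : Outcome}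
    (h : FinTree (P ∪ R) s o) (hs : Undefined P s.query) : FinTree R s o := by
  induction h with
  | empty V => exact .empty V
  | pos V A T f h ih =>
    have hiff : ∀ s, Resolves (P ∪ R) ⟨V, .pos A :: T⟩ s ↔ Resolves R ⟨V, .pos A :: T⟩ s :=
      fun s => ⟨fun h => (hext.resolves hs h).1, Resolves.mono Set.subset_union_right⟩
    simp only [hiff]
    exact .pos V A T f fun s hr => ih s ((hiff s).2 hr) (hext.resolves hs ((hiff s).2 hr)).2
  | negNonground V A T hA => exact .negNonground V A T hA
  | negSucceeded V A T hA h ih => exact .negSucceeded V A T hA (ih hs.pos_of_neg)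
  | negFloundered V A T hA h ih => exact .negFloundered V A T hA (ih hs.pos_of_neg)
  | negFailed V A T o hA h hT ih ihT =>
    exact .negFailed V A T o hA (ih hs.pos_of_neg) (ihT hs.tail)

theorem Extends.move (hext : Extends P R) {s t : Node L} (hs : Undefined P s.query)
    (h : Move (P ∪ R) s t) : Move R s t ∧ Undefined P t.query := by
  cases h with
  | resolve _ _ h =>
    have := hext.resolves hs h
    exact ⟨.resolve _ _ this.1, this.2⟩
  | call V A T hA => exact ⟨.call V A T hA, hs.pos_of_neg⟩
  | naf V A T hA h => exact ⟨.naf V A T hA (hext.finTree h hs.pos_of_neg), hs.tail⟩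

theorem Extends.terminates (hext : Extends P R) {s : Node L} (hs : Undefined P s.query)
    (h : Terminates R s) : Terminates (P ∪ R) s := by
  induction h with
  | intro s _ ih =>
    refine Acc.intro _ fun t ht => ?_
    have := hext.move hs ht
    exact ih t this.1 this.2

end Extensions

/-! ### Levels -/

section Levels

variable {P R : Program L} {D : Type w} [L.Structure D] {lev : LevelMapping L}

/-- Every ground instance of a literal of `Q` whose relation is defined in `P` has level below `N`,
provided that the literals before it are true in the structure. -/
def LevelsBelow (D : Type w) [L.Structure D] (P : Program L) (lev : LevelMapping L) (N : ℕ)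
    (Q : Query L) : Prop :=
  ∀ (As : Query L) (B : Literal L ℕ) (Bs : Query L), Q = As ++ B :: Bs → DefinedIn P B.rel →
    ∀ γ : ℕ → L.Term Empty, (∀ l ∈ As, (l.subst γ).Realize (Empty.elim : Empty → D)) →
      lev.lit (B.subst γ) < N

/-- A ground instance of `Tσ` is an instance of `T` under a substitution that makes `l` true, so `l`
may be put in front of the true prefix. -/
theorem LevelsBelow.tail {N : ℕ} {l : Literal L ℕ} {T : Query L} {σ : ℕ → L.Term ℕ}
    (h : LevelsBelow D P lev N (l :: T)) (hl : ∀ x : ℕ → D, (l.subst σ).Realize x) :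
    LevelsBelow D P lev N (Query.subst T σ) := by
  intro As B Bs hT hB γ hAs
  obtain ⟨As', Bs', rfl, rfl, hBs⟩ := List.map_eq_append_iff.1 hT
  obtain ⟨B', Bs', rfl, rfl, rfl⟩ := List.map_eq_cons_iff.1 hBs
  rw [Literal.rel_subst] at hB
  rw [Literal.subst_subst]
  refine h (l :: As') B' Bs' rfl hB _ ?_
  intro l' hl'
  rw [← Literal.subst_subst, Literal.realize_subst]
  rcases List.mem_cons.1 hl' with rfl | hl'
  · exact hl _
  · rw [← Literal.realize_subst]
    exact hAs _ (List.mem_map.2 ⟨l', hl', rfl⟩)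

/-- The strict decrease in acceptability turns the weak bound `N` on the head into a strict one on
the body. -/
theorem Acceptable.levelsBelow (hacc : Acceptable D P lev) {c : Clause L} (hc : c ∈ P)
    {σ : ℕ → L.Term ℕ} {N : ℕ} (hN : ∀ γ, lev ((c.head.subst σ).subst γ) ≤ N) :
    LevelsBelow D P lev N (Query.subst c.body σ) := by
  intro As B Bs hT hB γ hAs
  obtain ⟨As', Bs', hbody, rfl, hBs⟩ := List.map_eq_append_iff.1 hT
  obtain ⟨B', Bs', rfl, rfl, rfl⟩ := List.map_eq_cons_iff.1 hBs
  have hN := hN γ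
  rw [Atom.subst_subst] at hN
  rw [Literal.subst_subst]
  refine (hacc c hc _ As' B' Bs' hbody fun l hl => ?_).trans_le hN
  rw [← Literal.subst_subst]
  exact hAs _ (List.mem_map.2 ⟨l, hl, rfl⟩)

variable {C : Set (Query L)}

theorem terminates_of_not_definedIn (hext : Extends P R)
    (hR : ∀ Q ∈ C, AllDerivationsFinite R Q) {A : Atom L ℕ} (hA : [.pos A] ∈ C)
    (hdef : ¬ DefinedIn P A.rel) : Terminates (P ∪ R) (Node.root [.pos A]) := by
  refine hext.terminates ?_ (terminates_root_iff.2 (hR _ hA))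
  intro l hl
  obtain rfl := List.mem_singleton.1 hl
  exact hdef

theorem terminates_of_level_le [Nonempty L.Constants] [Nonempty D] (hext : Extends P R)
    (hM : IsCompleteModel D (P ∪ R)) (hC : IsClosedClass (P ∪ R) C) (hacc : Acceptable D P lev)
    (hR : ∀ Q ∈ C, AllDerivationsFinite R Q) (N : ℕ) (A : Atom L ℕ) (hA : [.pos A] ∈ C)
    (hdef : DefinedIn P A.rel) (hN : ∀ γ, lev (A.subst γ) ≤ N) :
    Terminates (P ∪ R) (Node.root [.pos A]) := by
  induction N using Nat.strong_induction_on generalizing A with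
  | _ N ih =>
  refine Acc.intro _ fun t ht => ?_
  have hvars : Query.vars t.query ⊆ t.used := ht.vars_subset subset_rfl
  have htC : t.query ∈ C := hC.mem_of_moves hA subset_rfl (.single ht)
  refine Terminates.of_root ?_ hvars
  have hinv : LevelsBelow D P lev N t.query ∧
      ∀ B, .neg B ∈ t.query → B.rel ∈ Neg (P ∪ R) := by
    cases ht with
    | resolve _ _ h =>
    cases h with
    | intro _ _ _ c hc ρ hρ θ hθ =>
    have hrel : A.rel = c.head.rel := hθ.rel_eq
    have hcP : c ∈ P := hc.resolve_right fun hcR => hext _ hdef ⟨c, hcR, Or.inl hrel.symm⟩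
    have hq : Query.subst ((c.rename ρ).body ++ []) θ =
        Query.subst c.body fun a => (Term.var (ρ a) : L.Term ℕ).subst θ := by
      rw [List.append_nil, ← Query.subst_subst]
      rfl
    simp only [hq]
    constructor
    · refine hacc.levelsBelow hcP fun γ => ?_
      -- The mgu identifies the instantiated head with an instance of `A`, so it inherits the bound
      -- `N`.
      have hhead := hθ.2.1
      rw [Clause.rename, Clause.subst, Atom.subst_subst] at hhead
      rw [← hhead, Atom.subst_subst]
      exact hN _
    · intro B hB
      obtain ⟨l, hl, hlB⟩ := List.mem_map.1 hB
      rcases l with l | l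
      · cases hlB
      cases hlB
      exact ⟨c, hc, l, hl, rfl⟩
  refine terminates_of_head_terminates hC
    (fun Q => LevelsBelow D P lev N Q ∧ ∀ B, .neg B ∈ Q → B.rel ∈ Neg (P ∪ R)) ?_ ?_ t.query htC hinv
  · rintro l T V σ W ⟨h1, h2⟩ h
    refine ⟨h1.tail fun x => ?_, fun B hB => ?_⟩
    -- The refuted literal is true in the model by soundness, which discharges the truth condition
    -- for the literals after it.
    · refine h.realize hM (fun B hB => h2 B ?_) x _ List.mem_cons_self
      obtain rfl := List.mem_singleton.1 hB
      exact List.mem_cons_self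
    · obtain ⟨l, hl, hlB⟩ := List.mem_map.1 hB
      rcases l with l | l
      · cases hlB
      cases hlB
      exact h2 l (List.mem_cons_of_mem _ hl)
  · rintro l T ⟨h1, -⟩ hl
    refine terminates_literal hC hl fun hlC => ?_
    by_cases hd : DefinedIn P l.rel
    · have hlt : ∀ γ, lev (l.atom.subst γ) < N := by
        intro γ
        rw [← Literal.atom_subst]
        exact h1 [] l T rfl hd γ (by simp)
      -- A constant supplies a ground instance; without one `hlt` would be vacuous and `N - 1` might
      -- not be smaller than `N`.
      have hpos : 0 < N :=
        Nat.zero_lt_of_lt (hlt fun _ => (Classical.arbitrary L.Constants).term)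
      exact ih (N - 1) (by omega) _ hlC hd fun γ => Nat.le_sub_one_of_lt (hlt γ)
    · exact terminates_of_not_definedIn hext hR hlC hd

end Levels

end LP

theorem theorem1 {L : FirstOrder.Language} [Nonempty L.Constants]
    (P R : LP.Program L) (hPfin : P.Finite) (hRfin : R.Finite)
    (hext : LP.Extends P R)
    (D : Type*) [L.Structure D] (hM : LP.IsCompleteModel D (P ∪ R))
    (C : Set (LP.Query L)) (hC : LP.IsClosedClass (P ∪ R) C)
    (lev : LP.LevelMapping L) (hacc : LP.Acceptable D P lev)
    (hR : ∀ Q ∈ C, LP.AllDerivationsFinite R Q)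
    (hbdd : ∀ A : LP.Atom L ℕ, [LP.Literal.pos A] ∈ C → LP.DefinedIn P A.rel → LP.Bounded lev A) :
    ∀ Q ∈ C, LP.AllDerivationsFinite (P ∪ R) Q := by
  have : Nonempty D := ⟨FirstOrder.Language.Structure.funMap
    (Classical.arbitrary L.Constants) (Fin.elim0 : Fin 0 → D)⟩
  intro Q hQ
  rw [← LP.terminates_root_iff]
  -- No invariant is needed at the top: boundedness gives each atom of the class defined in `P` a
  -- bound of its own.
  refine LP.terminates_of_head_terminates hC (fun _ => True) (fun _ _ _ _ _ _ _ => trivial)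
    (fun l _ _ hl => LP.terminates_literal hC hl fun hlC => ?_) Q hQ trivial
  by_cases hd : LP.DefinedIn P l.atom.rel
  · obtain ⟨N, hN⟩ := (hbdd _ hlC hd).bddAbove
    exact LP.terminates_of_level_le hext hM hC hacc hR N _ hlC hd fun γ => hN ⟨γ, rfl⟩
  · exact LP.terminates_of_not_definedIn hext hR hlC hd
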